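/- Let $d>0$ and $\mathcal{D}_d=\{z\in\mathbb{C} : |\operatorname{Im} z|<d\}$. Let $w:\mathcal{D}_d\to\mathbb{C}$ be a weight function, i.e. (1) $w$ is analytic and has no zeros on $\mathcal{D}_d$, and $w(x)\in(0,1]$ for $x\in\mathbb{R}$; (2) $\lim_{x\to\pm\infty}\int_{-d}^{d}|w(x+iy)|\,dy=0$, and $\lim_{y\nearrow d}\int_{-\infty}^{\infty}(|w(x+iy)|+|w(x-iy)|)\,dx$ exists and is finite; (3) $\log w$ is strictly concave on $\mathbb{R}$. Put $$K(x)=-\log\left|\tanh\left(\frac{\pi}{4d}x\right)\right|\quad(K(0)=+\infty),\qquad Q(x)=-\log w(x)\qquad(x\in\mathbb{R}),$$ and, for a positive Borel measure $\mu$ on $\mathbb{R}$, $$I(\mu)=\int_{\mathbb{R}}\int_{\mathbb{R}}K(x-y)\,d\mu(x)\,d\mu(y)+2\int_{\mathbb{R}}Q(x)\,d\mu(x)\in[0,\infty].$$ For an integer $n\ge 1$ let $F^{\mathrm C}_{K,Q}(n)=I(\mu_n^*)-\int_{\mathbb{R}}Q\,d\mu_n^*$, where $\mu_n^*$ is the minimizer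 of $I$ among all positive Borel measures $\mu$ on $\mathbb{R}$ with $\mu(\mathbb{R})=n$. Suppose that $w$ is even on $\mathbb{R}$, and let $n\ge1$ be an integer and $\alpha_n>0$ a real number with $$\frac{2\alpha_n}{\pi\tanh(d)}\cdot\frac{Q(\alpha_n)^2+Q'(\alpha_n)^2}{Q(\alpha_n)}\le n.$$ Then a minimizer $\mu_n^*$ exists, and for every such minimizer $$\frac{F^{\mathrm C}_{K,Q}(n)}{n}\ge\frac{Q(\alpha_n)}{2}.$$ -/

import Mathlib

open MeasureTheory Filter Topology Set
open scoped ENNReal NNReal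

namespace WeightedHardy

/-- The strip `{z | |Im z| < d}`. -/
def strip (d : ℝ) : Set ℂ := {z : ℂ | |z.im| < d}

/-- Weight functions on the strip of half-width `d`. Only the values of `w` on the strip matter.
The integrals of the nonnegative functions `|w|` are taken as Lebesgue integrals in `[0, ∞]`. -/
structure IsWeight (d : ℝ) (w : ℂ → ℂ) : Prop where
  /-- `w` is analytic on the strip. -/
  analytic : AnalyticOnNhd ℂ w (strip d)
  /-- `w` does not vanish on the strip. -/
  ne_zero : ∀ z ∈ strip d, w z ≠ 0
  /-- `w` takes values in `(0, 1]` on the real line. -/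
  real_values : ∀ x : ℝ, ∃ r ∈ Ioc (0 : ℝ) 1, w (x : ℂ) = (r : ℂ)
  /-- `∫_{-d}^{d} |w(x + iy)| dy → 0` as `x → ∞`. -/
  decay_atTop : Tendsto
    (fun x : ℝ => ∫⁻ y in Ioo (-d) d, ‖w ((x : ℂ) + (y : ℂ) * Complex.I)‖ₑ) atTop (𝓝 0)
  /-- `∫_{-d}^{d} |w(x + iy)| dy → 0` as `x → -∞`. -/
  decay_atBot : Tendsto
    (fun x : ℝ => ∫⁻ y in Ioo (-d) d, ‖w ((x : ℂ) + (y : ℂ) * Complex.I)‖ₑ) atBot (𝓝 0)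
  /-- The limit of `∫ (|w(x + iy)| + |w(x - iy)|) dx` as `y ↗ d` exists and is finite. -/
  boundary : ∃ L : ℝ≥0, Tendsto
    (fun y : ℝ => ∫⁻ x : ℝ, (‖w ((x : ℂ) + (y : ℂ) * Complex.I)‖ₑ
      + ‖w ((x : ℂ) - (y : ℂ) * Complex.I)‖ₑ)) (𝓝[<] d) (𝓝 (L : ℝ≥0∞))
  /-- `log w` is strictly concave on the real line. -/
  log_concave : StrictConcaveOn ℝ univ (fun x : ℝ => Real.log (w (x : ℂ)).re)

/-- The external field `Q(x) = -log w(x)` on the real line, where `w` is real and positive. -/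
noncomputable def extField (w : ℂ → ℂ) (x : ℝ) : ℝ := -Real.log (w (x : ℂ)).re

/-- The kernel `K(x) = -log |tanh (π x / (4 d))|`, with values in `[0, ∞]` and `K(0) = ∞`. -/
noncomputable def kernel (d : ℝ) (x : ℝ) : ℝ≥0∞ :=
  if x = 0 then ⊤ else ENNReal.ofReal (-Real.log |Real.tanh (Real.pi / (4 * d) * x)|)

/-- The integral `∫ Q dμ`, with values in `[0, ∞]` (here `Q ≥ 0` since `w ≤ 1`). -/
noncomputable def fieldIntegral (w : ℂ → ℂ) (μ : Measure ℝ) : ℝ≥0∞ :=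
  ∫⁻ x, ENNReal.ofReal (extField w x) ∂μ

/-- The energy `I(μ) = ∬ K(x - y) dμ(x) dμ(y) + 2 ∫ Q dμ`, with values in `[0, ∞]`. -/
noncomputable def energy (d : ℝ) (w : ℂ → ℂ) (μ : Measure ℝ) : ℝ≥0∞ :=
  (∫⁻ y, ∫⁻ x, kernel d (x - y) ∂μ ∂μ) + 2 * fieldIntegral w μ

/-- `μ` minimizes the energy among all positive Borel measures on `ℝ` of total mass `n`. -/
def IsEnergyMinimizer (d : ℝ) (w : ℂ → ℂ) (n : ℕ) (μ : Measure ℝ) : Prop :=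
  μ univ = (n : ℝ≥0∞) ∧
    ∀ ν : Measure ℝ, ν univ = (n : ℝ≥0∞) → energy d w μ ≤ energy d w ν

/-- The number `I(μ) - ∫ Q dμ`; for the energy minimizer `μ` of mass `n` it is `F^C_{K,Q}(n)`.
Both terms are finite there, because the minimal energy is finite. -/
noncomputable def FC (d : ℝ) (w : ℂ → ℂ) (μ : Measure ℝ) : ℝ :=
  (energy d w μ).toReal - (fieldIntegral w μ).toReal

end WeightedHardy

/-!
The lower bound holds for every measure `μ` of mass `n` and finite energy; that `μ` minimizes the
energy is used only to know that its energy is finite. Write `q = Q(α)`, `E = ∬ K(x - y) dμ dμ` and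
`B = ∫_{[-α, α]} (q - Q) dμ`. Since `Q` is even and convex, `Q ≥ q` off `[-α, α]`, so
`∫ Q dμ ≥ n q - B` and `E + ∫ Q dμ ≥ E + n q - B`. By the arithmetic-geometric mean inequality the
right-hand side is at least `n q / 2` as soon as `B² ≤ 2 n q E`, and the hypothesis on `α` is what
gives this bound.

To compare `B` with `E`, expand `K` in positive multiples of exponentials,
`K(x) = ∑ (2 / k) exp (-a_k |x|)` over odd `k`, with `a_k = k π / (2 d)`; a partial sum is a lower
bound for `K` (`sum_exp_le_kernel`). For each exponential kernel, `sq_integral_le_mul_expEnergy` gives,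
after the integration by parts `integral_sq_sub_deriv`, a Cauchy-Schwarz inequality: for `f` of
class `C¹` vanishing at the end points of an interval that carries `μ`,
`2 a (∫ f dμ)² ≤ (∫ (a² f² + f'²)) ∬ exp (-a |x - y|) dμ dμ`.
It comes from writing `exp (-a |x - y|)` as `2 a` times the `L²` inner product of two one-sided
exponentials, while `f` is the one-sided exponential transform of `a f - f'`. With `f = q - Q` one
has `0 ≤ f ≤ q` and `|f'| ≤ Q'(α)` on `[-α, α]`. Summing over `k` leaves a partial fraction
sum of the hyperbolic tangent, which only has to be bounded below up to a factor `2`;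
`tanh_div_le_sum` does this with `⌈d / 4⌉` terms.

A minimizer exists by the direct method: the energy is lower semicontinuous for weak convergence
(`lowerSemicontinuous_energy_smul`), because `K` and `Q` are continuous and nonnegative, its
sublevel sets are tight because `Q` tends to infinity, and Prokhorov's theorem applies. The uniform
distribution on `[0, 1]` shows that the minimal energy is finite.
-/

namespace WeightedHardy

variable {d : ℝ} {w : ℂ → ℂ}

/-! ### Energies for exponential kernels -/

/-- The kernel `exp (-a (t - x))` for `t ≥ x`, extended by zero to `t < x`: the fundamental solution
of `h' + a h = δ_x` in the variable `t`. -/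
noncomputable def causalExp (a x t : ℝ) : ℝ := if x ≤ t then Real.exp (-a * (t - x)) else 0

lemma measurable_causalExp (a : ℝ) : Measurable fun z : ℝ × ℝ => causalExp a z.1 z.2 := by
  unfold causalExp
  exact Measurable.ite (measurableSet_le measurable_fst measurable_snd) (by fun_prop) measurable_const

lemma causalExp_nonneg (a x t : ℝ) : 0 ≤ causalExp a x t := by
  unfold causalExp; split_ifs <;> positivity

lemma causalExp_le_one {a : ℝ} (ha : 0 ≤ a) (x t : ℝ) : causalExp a x t ≤ 1 := by
  unfold causalExp
  split_ifs with h
  · rw [Real.exp_le_one_iff]; nlinarith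
  · exact zero_le_one

lemma causalExp_norm_le {a : ℝ} (ha : 0 ≤ a) (x t : ℝ) : ‖causalExp a x t‖ ≤ 1 := by
  rw [Real.norm_of_nonneg (causalExp_nonneg a x t)]; exact causalExp_le_one ha x t

/-- A function vanishing at the right end point is recovered from `a f - f'` by integration against
the one-sided exponential, the formal adjoint of its defining equation. -/
lemma integral_causalExp_mul {a b c : ℝ} {f f' : ℝ → ℝ} (hf : ∀ x, HasDerivAt f (f' x) x)
    (hf' : Continuous f') (hc : f c = 0) {x : ℝ} (hx : x ∈ Icc b c) :
    ∫ t in Icc b c, causalExp a x t * (a * f t - f' t) = f x := by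
  have hfc : Continuous f := continuous_iff_continuousAt.2 fun x => (hf x).continuousAt
  have h1 : ∀ t, causalExp a x t * (a * f t - f' t)
      = (Ici x).indicator (fun t => Real.exp (-a * (t - x)) * (a * f t - f' t)) t := by
    intro t
    unfold causalExp indicator
    simp only [mem_Ici]
    split_ifs <;> simp
  simp_rw [h1]
  rw [setIntegral_indicator measurableSet_Ici]
  have h2 : Icc b c ∩ Ici x = Icc x c := by
    ext t; simp only [mem_inter_iff, mem_Icc, mem_Ici]
    exact ⟨fun h => ⟨h.2, h.1.2⟩, fun h => ⟨⟨hx.1.trans h.1, h.2⟩, h.1⟩⟩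
  rw [h2, integral_Icc_eq_integral_Ioc, ← intervalIntegral.integral_of_le hx.2]
  have h3 : ∀ t ∈ uIcc x c, HasDerivAt (fun t => -(Real.exp (-a * (t - x)) * f t))
      (Real.exp (-a * (t - x)) * (a * f t - f' t)) t := by
    intro t _
    have e : HasDerivAt (fun t => Real.exp (-a * (t - x))) (Real.exp (-a * (t - x)) * (-a)) t := by
      simpa using (((hasDerivAt_id t).sub_const x).const_mul (-a)).exp
    convert! (e.mul (hf t)).neg using 1
    ring
  rw [intervalIntegral.integral_eq_sub_of_hasDerivAt h3
    (Continuous.intervalIntegrable (by fun_prop) _ _)]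
  simp [hc]

/-- There is equality when the integral runs over the whole line. -/
lemma two_mul_integral_causalExp_mul_le {a b c : ℝ} (ha : 0 < a) (x y : ℝ) :
    2 * a * ∫ t in Icc b c, causalExp a x t * causalExp a y t ≤ Real.exp (-a * |x - y|) := by
  have h1 : ∀ t, causalExp a x t * causalExp a y t = (Ici (max x y)).indicator
      (fun t => Real.exp (a * (x + y)) * Real.exp (-(2 * a) * t)) t := by
    intro t
    unfold causalExp indicator
    simp only [mem_Ici, max_le_iff]
    by_cases h : x ≤ t <;> by_cases h' : y ≤ t <;> simp [h, h']
    rw [← Real.exp_add, ← Real.exp_add]; congr 1; ring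
  have hi : IntegrableOn (fun t => Real.exp (a * (x + y)) * Real.exp (-(2 * a) * t))
      (Ici (max x y)) := by
    rw [integrableOn_Ici_iff_integrableOn_Ioi]
    exact (integrableOn_exp_mul_Ioi (by linarith) _).const_mul _
  have h2 : ∫ t in Icc b c, causalExp a x t * causalExp a y t ≤
      ∫ t in Ici (max x y), Real.exp (a * (x + y)) * Real.exp (-(2 * a) * t) := by
    rw [← integral_indicator measurableSet_Ici]
    simp_rw [h1]
    apply setIntegral_le_integral
    · exact (integrable_indicator_iff measurableSet_Ici).2 hi
    · exact ae_of_all _ fun t => indicator_nonneg (fun _ _ => by positivity) _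
  have h3 : ∫ t in Ici (max x y), Real.exp (a * (x + y)) * Real.exp (-(2 * a) * t)
      = Real.exp (-a * |x - y|) / (2 * a) := by
    rw [integral_Ici_eq_integral_Ioi, integral_const_mul, integral_exp_mul_Ioi (by linarith),
      neg_div_neg_eq, ← mul_div_assoc, ← Real.exp_add]
    congr 2
    rcases le_total x y with h | h
    · rw [max_eq_right h, abs_of_nonpos (by linarith)]; ring
    · rw [max_eq_left h, abs_of_nonneg (by linarith)]; ring
  rw [h3] at h2
  calc _ ≤ 2 * a * (Real.exp (-a * |x - y|) / (2 * a)) := by gcongr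
    _ = _ := by field_simp

/-- The Cauchy-Schwarz inequality for real Bochner integrals, without exponents. -/
lemma sq_integral_mul_le {X : Type*} [MeasurableSpace X] {m : Measure X} {g h : X → ℝ}
    (hg : Integrable (fun x => g x ^ 2) m) (hh : Integrable (fun x => h x ^ 2) m)
    (hgh : Integrable (fun x => g x * h x) m) :
    (∫ x, g x * h x ∂m) ^ 2 ≤ (∫ x, g x ^ 2 ∂m) * ∫ x, h x ^ 2 ∂m := by
  have key : ∀ s : ℝ, 0 ≤ (∫ x, g x ^ 2 ∂m) * (s * s) + (2 * ∫ x, g x * h x ∂m) * s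
      + ∫ x, h x ^ 2 ∂m := by
    intro s
    have : 0 ≤ ∫ x, (s * g x + h x) ^ 2 ∂m := integral_nonneg fun x => sq_nonneg _
    have e : ∀ x, (s * g x + h x) ^ 2 = s * s * g x ^ 2 + 2 * s * (g x * h x) + h x ^ 2 := by
      intro x; ring
    simp_rw [e] at this
    have i1 := hg.const_mul (s * s)
    have i2 := hgh.const_mul (2 * s)
    have i3 : Integrable (fun x => s * s * g x ^ 2 + 2 * s * (g x * h x)) m := i1.add i2
    rw [integral_add i3 hh, integral_add i1 i2, integral_const_mul,
      integral_const_mul] at this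
    linarith
  have := discrim_le_zero key
  unfold discrim at this
  nlinarith

/-- Duality between the energy of the kernel `exp (-a |x|)` and the Sobolev norm of a test function
vanishing at the right end of the interval that carries `μ`. -/
theorem sq_integral_le_mul_expEnergy {a b c : ℝ} (ha : 0 < a) {f f' : ℝ → ℝ}
    (hf : ∀ x, HasDerivAt f (f' x) x) (hf' : Continuous f') (hc : f c = 0)
    (μ : Measure ℝ) [IsFiniteMeasure μ] (hμ : ∀ᵐ x ∂μ, x ∈ Icc b c) :
    2 * a * (∫ x, f x ∂μ) ^ 2 ≤ (∫ t in Icc b c, (a * f t - f' t) ^ 2) *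
      ∫ z, Real.exp (-a * |z.1 - z.2|) ∂(μ.prod μ) := by
  have hfc : Continuous f := continuous_iff_continuousAt.2 fun x => (hf x).continuousAt
  set g : ℝ → ℝ := fun t => a * f t - f' t with hg
  have hgc : Continuous g := by fun_prop
  set m : Measure ℝ := volume.restrict (Icc b c) with hm
  have hgi : Integrable g m := hgc.integrableOn_Icc
  have hg2 : Integrable (fun t => g t ^ 2) m :=
    Continuous.integrableOn_Icc (f := fun t => g t ^ 2) (by fun_prop)
  set h : ℝ → ℝ := fun t => ∫ x, causalExp a x t ∂μ with hh
  have hmeas := measurable_causalExp a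
  have hhm : StronglyMeasurable h := by
    have : StronglyMeasurable fun z : ℝ × ℝ => causalExp a z.2 z.1 :=
      (hmeas.comp measurable_swap).stronglyMeasurable
    exact this.integral_prod_right'
  have hhb : ∀ t, ‖h t‖ ≤ 1 * μ.real univ := fun t =>
    norm_integral_le_of_norm_le_const (ae_of_all _ fun x => causalExp_norm_le ha.le x t)
  have hgh : Integrable (fun t => g t * h t) m :=
    hgi.mul_bdd hhm.aestronglyMeasurable (ae_of_all _ hhb)
  have hh2 : Integrable (fun t => h t ^ 2) m := by
    refine Integrable.of_bound (hhm.pow 2).aestronglyMeasurable ((1 * μ.real univ) ^ 2)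
      (ae_of_all _ fun t => ?_)
    rw [norm_pow]
    exact pow_le_pow_left₀ (norm_nonneg _) (hhb t) 2
  -- Both sides are expressed through the potential `h`; Cauchy-Schwarz in `L²(m)` then applies.
  have e1 : ∫ x, f x ∂μ = ∫ t, g t * h t ∂m := by
    have : ∫ x, f x ∂μ = ∫ x, ∫ t, causalExp a x t * g t ∂m ∂μ :=
      integral_congr_ae (hμ.mono fun x hx => (integral_causalExp_mul hf hf' hc hx).symm)
    rw [this, integral_integral_swap]
    · refine integral_congr_ae (ae_of_all _ fun t => ?_)
      simp only [hh]
      rw [integral_mul_const, mul_comm]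
    · exact (hgi.comp_snd μ).bdd_mul hmeas.aestronglyMeasurable
        (ae_of_all _ fun z => causalExp_norm_le ha.le z.1 z.2)
  have e2 : 2 * a * ∫ t, h t ^ 2 ∂m ≤ ∫ z, Real.exp (-a * |z.1 - z.2|) ∂(μ.prod μ) := by
    have s1 : ∫ t, h t ^ 2 ∂m
        = ∫ t, ∫ z, causalExp a z.1 t * causalExp a z.2 t ∂(μ.prod μ) ∂m := by
      refine integral_congr_ae (ae_of_all _ fun t => ?_)
      simp only [hh]
      rw [integral_prod_mul (fun x => causalExp a x t) (fun x => causalExp a x t), sq]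
    have hint : Integrable (Function.uncurry fun (t : ℝ) (z : ℝ × ℝ) =>
        causalExp a z.1 t * causalExp a z.2 t) (m.prod (μ.prod μ)) := by
      refine Integrable.of_bound (Measurable.aestronglyMeasurable ?_) 1 (ae_of_all _ fun z => ?_)
      · exact (hmeas.comp (by fun_prop : Measurable fun z : ℝ × ℝ × ℝ => (z.2.1, z.1))).mul
          (hmeas.comp (by fun_prop : Measurable fun z : ℝ × ℝ × ℝ => (z.2.2, z.1)))
      · simp only [Function.uncurry, norm_mul]
        exact mul_le_one₀ (causalExp_norm_le ha.le _ _) (norm_nonneg _)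
          (causalExp_norm_le ha.le _ _)
    rw [s1, integral_integral_swap hint, ← integral_const_mul]
    refine integral_mono (hint.integral_prod_right.const_mul _) ?_ fun z =>
      two_mul_integral_causalExp_mul_le ha z.1 z.2
    refine Integrable.of_bound (Continuous.aestronglyMeasurable (by fun_prop)) 1
      (ae_of_all _ fun z => ?_)
    rw [Real.norm_of_nonneg (Real.exp_pos _).le, Real.exp_le_one_iff]
    nlinarith [abs_nonneg (z.1 - z.2)]
  have e3 := sq_integral_mul_le hg2 hh2 hgh
  rw [← e1] at e3
  calc 2 * a * (∫ x, f x ∂μ) ^ 2 ≤ 2 * a * ((∫ t, g t ^ 2 ∂m) * ∫ t, h t ^ 2 ∂m) := by gcongr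
    _ = (∫ t, g t ^ 2 ∂m) * (2 * a * ∫ t, h t ^ 2 ∂m) := by ring
    _ ≤ _ := mul_le_mul_of_nonneg_left e2 (integral_nonneg fun t => sq_nonneg _)

/-- The cross term is the integral of the derivative of `a f²`, which vanishes. -/
lemma integral_sq_sub_deriv {a b c : ℝ} (hbc : b ≤ c) {f f' : ℝ → ℝ}
    (hf : ∀ x, HasDerivAt f (f' x) x) (hf' : Continuous f') (hb : f b = 0) (hc : f c = 0) :
    ∫ t in Icc b c, (a * f t - f' t) ^ 2
      = a ^ 2 * (∫ t in Icc b c, f t ^ 2) + ∫ t in Icc b c, f' t ^ 2 := by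
  have hfc : Continuous f := continuous_iff_continuousAt.2 fun x => (hf x).continuousAt
  have h0 : ∫ t in Icc b c, 2 * f t * f' t = 0 := by
    rw [integral_Icc_eq_integral_Ioc, ← intervalIntegral.integral_of_le hbc,
      intervalIntegral.integral_eq_sub_of_hasDerivAt (f := fun t => f t ^ 2)
        (fun t _ => by simpa using! (hf t).pow 2)
        (Continuous.intervalIntegrable (by fun_prop) _ _)]
    simp [hb, hc]
  have e : ∀ t, (a * f t - f' t) ^ 2
      = a ^ 2 * f t ^ 2 + f' t ^ 2 - a * (2 * f t * f' t) := by intro t; ring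
  simp_rw [e]
  have i1 : IntegrableOn (fun t => a ^ 2 * f t ^ 2) (Icc b c) :=
    Continuous.integrableOn_Icc (by fun_prop)
  have i2 : IntegrableOn (fun t => f' t ^ 2) (Icc b c) :=
    Continuous.integrableOn_Icc (by fun_prop)
  have i3 : IntegrableOn (fun t => a * (2 * f t * f' t)) (Icc b c) :=
    Continuous.integrableOn_Icc (by fun_prop)
  have i4 : IntegrableOn (fun t => a ^ 2 * f t ^ 2 + f' t ^ 2) (Icc b c) := i1.add i2
  rw [integral_sub i4 i3, integral_add i1 i2, integral_const_mul, integral_const_mul, h0]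
  ring

/-! ### The kernel -/

lemma tanh_pos {u : ℝ} (hu : 0 < u) : 0 < Real.tanh u := by
  rw [Real.tanh_eq_sinh_div_cosh]
  exact div_pos (Real.sinh_pos_iff.2 hu) (Real.cosh_pos u)

lemma tanh_ne_zero {u : ℝ} (hu : u ≠ 0) : Real.tanh u ≠ 0 := by
  rw [← Real.tanh_zero]
  exact fun h => hu (Real.tanh_injective h)

lemma tanh_le_self {u : ℝ} (hu : 0 ≤ u) : Real.tanh u ≤ u := by
  rw [Real.tanh_eq_sinh_div_cosh, div_le_iff₀ (Real.cosh_pos u)]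
  have : MonotoneOn (fun u => u * Real.cosh u - Real.sinh u) (Ici 0) := by
    apply monotoneOn_of_deriv_nonneg (convex_Ici 0) (by fun_prop)
      (Differentiable.differentiableOn (by fun_prop))
    intro x hx
    rw [interior_Ici, mem_Ioi] at hx
    have : HasDerivAt (fun u => u * Real.cosh u - Real.sinh u)
        (1 * Real.cosh x + x * Real.sinh x - Real.cosh x) x :=
      ((hasDerivAt_id x).mul (Real.hasDerivAt_cosh x)).sub (Real.hasDerivAt_sinh x)
    rw [this.deriv]
    have := mul_nonneg hx.le (Real.sinh_nonneg_iff.2 hx.le)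
    linarith
  have := this (mem_Ici.2 le_rfl) (mem_Ici.2 hu) hu
  simp at this
  linarith

lemma continuous_tanh : Continuous Real.tanh := by
  have : Real.tanh = fun x => Real.sinh x / Real.cosh x := funext Real.tanh_eq_sinh_div_cosh
  rw [this]
  exact Real.continuous_sinh.div Real.continuous_cosh fun x => (Real.cosh_pos x).ne'

lemma abs_tanh (u : ℝ) : |Real.tanh u| = Real.tanh |u| := by
  rcases le_total 0 u with h | h
  · rw [abs_of_nonneg h]
    rcases h.eq_or_lt with rfl | h
    · simp
    · exact abs_of_pos (tanh_pos h)
  · rw [abs_of_nonpos h, Real.tanh_neg]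
    rcases h.eq_or_lt with rfl | h
    · simp
    · rw [abs_of_neg]
      have := tanh_pos (neg_pos.2 h)
      rw [Real.tanh_neg] at this
      linarith

lemma continuous_kernel (hd : 0 < d) : Continuous (kernel d) := by
  have hc : Real.pi / (4 * d) ≠ 0 := by positivity
  refine continuous_iff_continuousAt.2 fun x => ?_
  rcases eq_or_ne x 0 with rfl | hx
  · rw [ContinuousAt, kernel, if_pos rfl, ← nhdsNE_sup_pure, tendsto_sup]
    constructor
    · have h1 : Tendsto (fun x => Real.tanh (Real.pi / (4 * d) * x)) (𝓝[≠] 0) (𝓝[≠] 0) := by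
        refine tendsto_nhdsWithin_iff.2 ⟨?_, ?_⟩
        · have : Continuous fun x => Real.tanh (Real.pi / (4 * d) * x) :=
            continuous_tanh.comp (continuous_const_mul _)
          simpa using (this.tendsto 0).mono_left nhdsWithin_le_nhds
        · filter_upwards [self_mem_nhdsWithin] with x hx
          exact tanh_ne_zero (mul_ne_zero hc hx)
      have h2 := ENNReal.tendsto_ofReal_atTop.comp
        (tendsto_neg_atBot_atTop.comp (Real.tendsto_log_nhdsNE_zero.comp h1))
      refine h2.congr' ?_
      filter_upwards [self_mem_nhdsWithin] with x hx
      simp [kernel, if_neg (show x ≠ 0 from hx), Real.log_abs]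
    · rw [tendsto_pure_left]
      intro s hs
      simpa [kernel] using mem_of_mem_nhds hs
  · have h1 : ContinuousAt (fun x => ENNReal.ofReal
        (-Real.log |Real.tanh (Real.pi / (4 * d) * x)|)) x := by
      refine ENNReal.continuous_ofReal.continuousAt.comp ?_
      refine (ContinuousAt.log ?_ ?_).neg
      · exact (continuous_tanh.comp (continuous_const_mul _)).abs.continuousAt
      · exact abs_ne_zero.2 (tanh_ne_zero (mul_ne_zero hc hx))
    refine h1.congr ?_
    filter_upwards [isOpen_ne.mem_nhds hx] with y hy
    rw [kernel, if_neg hy]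

/-- Partial sums of the expansion of `K` in exponentials, obtained from
`-log (tanh u) = log (1 + q) - log (1 - q)` with `q = exp (-2 u)`. -/
lemma sum_exp_le_kernel (hd : 0 < d) (N : ℕ) (x : ℝ) :
    ENNReal.ofReal (∑ j ∈ Finset.range N, 2 / (2 * j + 1 : ℝ) *
      Real.exp (-((2 * j + 1) * Real.pi / (2 * d)) * |x|)) ≤ kernel d x := by
  rw [kernel]
  split_ifs with hx
  · exact le_top
  apply ENNReal.ofReal_le_ofReal
  set u := Real.pi / (4 * d) * |x| with hu
  have hu0 : 0 < u := by have := abs_pos.2 hx; positivity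
  have hd0 : d ≠ 0 := hd.ne'
  set q := Real.exp (-2 * u) with hq
  have hq1 : q < 1 := by rw [hq, Real.exp_lt_one_iff]; linarith
  have hq0 : 0 < q := Real.exp_pos _
  have hs := Real.hasSum_log_sub_log_of_abs_lt_one (x := q) (by rwa [abs_of_pos hq0])
  have hK : -Real.log |Real.tanh (Real.pi / (4 * d) * x)|
      = Real.log (1 + q) - Real.log (1 - q) := by
    rw [abs_tanh, abs_mul, abs_of_pos (by positivity : 0 < Real.pi / (4 * d)), ← hu,
      ← Real.log_inv, ← Real.log_div (by linarith) (by linarith), Real.tanh_eq, inv_div]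
    congr 1
    have hm : q = Real.exp (-u) * Real.exp (-u) := by rw [← Real.exp_add, hq]; congr 1; ring
    have hp : Real.exp u * Real.exp (-u) = 1 := by rw [← Real.exp_add]; simp
    have h1 : Real.exp u - Real.exp (-u) ≠ 0 := by
      have : Real.exp (-u) < Real.exp u := Real.exp_lt_exp.2 (by linarith)
      linarith
    rw [div_eq_div_iff h1 (by linarith), hm]
    linear_combination (-2 * Real.exp (-u)) * hp
  rw [hK, ← hs.tsum_eq]
  refine le_trans (le_of_eq ?_) (hs.summable.sum_le_tsum (Finset.range N)
    fun j _ => by positivity)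
  refine Finset.sum_congr rfl fun j _ => ?_
  rw [hq, ← Real.exp_nat_mul, mul_one_div]
  congr 2
  rw [hu]; push_cast; field_simp; ring

/-- The singularity of `K` at the origin is logarithmic, since `tanh u ≥ u / cosh c` on `[0, c]`. -/
lemma kernel_le (hd : 0 < d) {x : ℝ} (hx : |x| ≤ 1) (hx0 : x ≠ 0) :
    kernel d x ≤ ENNReal.ofReal
      (Real.log (Real.cosh (Real.pi / (4 * d)) / (Real.pi / (4 * d))) - Real.log x) := by
  rw [kernel, if_neg hx0]
  apply ENNReal.ofReal_le_ofReal
  set c := Real.pi / (4 * d) with hcdef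
  have hc : 0 < c := by positivity
  have hxp := abs_pos.2 hx0
  have h1 : c * |x| / Real.cosh c ≤ Real.tanh (c * |x|) := by
    rw [Real.tanh_eq_sinh_div_cosh]
    have e1 := Real.self_le_sinh_iff.2 (by positivity : 0 ≤ c * |x|)
    have e2 : Real.cosh (c * |x|) ≤ Real.cosh c := by
      rw [Real.cosh_le_cosh, abs_of_pos hc, abs_of_nonneg (by positivity)]
      nlinarith
    exact div_le_div₀ (Real.sinh_nonneg_iff.2 (by positivity)) e1 (Real.cosh_pos _) e2
  have h2 := Real.log_le_log (by have := Real.cosh_pos c; positivity) h1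
  rw [abs_tanh, abs_mul, abs_of_pos hc]
  have hch := Real.cosh_pos c
  rw [Real.log_div (by positivity) hch.ne', Real.log_mul hc.ne' hxp.ne', Real.log_abs] at h2
  rw [Real.log_div hch.ne' hc.ne']
  linarith

lemma lintegral_kernel_lt_top (hd : 0 < d) :
    ∫⁻ x in Icc (-1 : ℝ) 1, kernel d x < ∞ := by
  set C := Real.log (Real.cosh (Real.pi / (4 * d)) / (Real.pi / (4 * d)))
  have hi : IntegrableOn (fun x => C - Real.log x) (Icc (-1 : ℝ) 1) := by
    rw [integrableOn_Icc_iff_integrableOn_Ioc,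
      ← intervalIntegrable_iff_integrableOn_Ioc_of_le (by norm_num)]
    exact intervalIntegrable_const.sub intervalIntegral.intervalIntegrable_log'
  refine lt_of_le_of_lt ?_ hi.lintegral_lt_top
  refine lintegral_mono_ae ?_
  have h0 : ∀ᵐ x ∂(volume.restrict (Icc (-1 : ℝ) 1)), x ≠ 0 :=
    ae_restrict_of_ae (by simp [ae_iff])
  filter_upwards [h0, ae_restrict_mem measurableSet_Icc] with x hx hx'
  exact kernel_le hd (abs_le.2 hx') hx

lemma lintegral_kernel_unit_lt_top (hd : 0 < d) :
    ∫⁻ y in Icc (0 : ℝ) 1, ∫⁻ x in Icc (0 : ℝ) 1, kernel d (x - y) < ∞ := by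
  have hk := (continuous_kernel hd).measurable
  have h : ∀ y ∈ Icc (0 : ℝ) 1, ∫⁻ x in Icc (0 : ℝ) 1, kernel d (x - y)
      ≤ ∫⁻ x in Icc (-1 : ℝ) 1, kernel d x := by
    intro y hy
    rw [← lintegral_indicator measurableSet_Icc, ← lintegral_indicator measurableSet_Icc,
      ← lintegral_sub_right_eq_self (fun x => (Icc (-1 : ℝ) 1).indicator (kernel d) x) y]
    refine lintegral_mono fun x => ?_
    by_cases hx : x ∈ Icc (0 : ℝ) 1
    · rw [indicator_of_mem hx, indicator_of_mem]
      constructor <;> linarith [hx.1, hx.2, hy.1, hy.2]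
    · rw [indicator_of_notMem hx]; exact zero_le
  refine lt_of_le_of_lt (setLIntegral_mono measurable_const h) ?_
  simpa using lintegral_kernel_lt_top hd

/-! ### Existence of a minimizer -/

/-- Truncation at a natural number makes the integrand bounded and continuous, so the integral is a
supremum of weakly continuous functions. -/
lemma lowerSemicontinuous_lintegral {X : Type*} [TopologicalSpace X] [MeasurableSpace X]
    [OpensMeasurableSpace X] {g : X → ℝ≥0∞} (hg : Continuous g) :
    LowerSemicontinuous fun p : ProbabilityMeasure X => ∫⁻ x, g x ∂(p : Measure X) := by
  have h1 : ∀ m : ℕ, Continuous fun p : ProbabilityMeasure X =>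
      ∫⁻ x, min (g x) m ∂(p : Measure X) := by
    intro m
    have hne : ∀ x, min (g x) (m : ℝ≥0∞) ≠ ∞ := fun x =>
      ne_top_of_le_ne_top (ENNReal.natCast_ne_top m) (min_le_right _ _)
    have hc : Continuous fun x => (min (g x) (m : ℝ≥0∞)).toNNReal :=
      continuous_iff_continuousAt.2 fun x =>
        (ENNReal.tendsto_toNNReal (hne x)).comp (hg.min continuous_const).continuousAt
    let G : BoundedContinuousFunction X ℝ≥0 := BoundedContinuousFunction.mkOfBound ⟨_, hc⟩ m (by
      intro x y
      have hb : ∀ x, (min (g x) (m : ℝ≥0∞)).toNNReal ≤ m := fun x => by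
        rw [← ENNReal.coe_le_coe, ENNReal.coe_toNNReal (hne x)]
        exact min_le_right _ _
      have hx : (((min (g x) (m : ℝ≥0∞)).toNNReal : ℝ≥0) : ℝ) ≤ m := by exact_mod_cast hb x
      have hy : (((min (g y) (m : ℝ≥0∞)).toNNReal : ℝ≥0) : ℝ) ≤ m := by exact_mod_cast hb y
      simp only [ContinuousMap.coe_mk, NNReal.dist_eq, abs_le]
      constructor <;> linarith [NNReal.coe_nonneg (min (g x) (m : ℝ≥0∞)).toNNReal,
        NNReal.coe_nonneg (min (g y) (m : ℝ≥0∞)).toNNReal])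
    have hG : ∀ x, ((G x : ℝ≥0) : ℝ≥0∞) = min (g x) m := fun x => ENNReal.coe_toNNReal (hne x)
    have := ProbabilityMeasure.continuous_iff_forall_continuous_lintegral.1
      (continuous_id (X := ProbabilityMeasure X)) G
    simpa only [hG, id] using this
  have h2 : ∀ p : ProbabilityMeasure X,
      ∫⁻ x, g x ∂(p : Measure X) = ⨆ m : ℕ, ∫⁻ x, min (g x) m ∂(p : Measure X) := by
    intro p
    rw [← lintegral_iSup (fun m => (hg.min continuous_const).measurable)
      (fun i j hij x => min_le_min_left _ (by exact_mod_cast hij))]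
    refine lintegral_congr fun x => ?_
    rw [← inf_iSup_eq, ENNReal.iSup_natCast, inf_top_eq]
  simp_rw [h2]
  exact lowerSemicontinuous_iSup fun m => (h1 m).lowerSemicontinuous

lemma energy_eq_prod (hd : 0 < d) (μ : Measure ℝ) [SFinite μ] :
    energy d w μ = ∫⁻ z : ℝ × ℝ, kernel d (z.1 - z.2) ∂(μ.prod μ) + 2 * fieldIntegral w μ := by
  rw [energy, lintegral_prod_symm]
  exact ((continuous_kernel hd).comp (by fun_prop)).measurable.aemeasurable

lemma energy_smul (μ : Measure ℝ) {c : ℝ≥0∞} (hc : c ≠ ∞) :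
    energy d w (c • μ) = c * (c * ∫⁻ y, ∫⁻ x, kernel d (x - y) ∂μ ∂μ)
      + 2 * (c * fieldIntegral w μ) := by
  simp only [energy, fieldIntegral, lintegral_smul_measure, smul_eq_mul]
  rw [lintegral_const_mul' _ _ hc]

/-- A multiple of the uniform distribution on `[0, 1]` has finite energy. -/
lemma exists_energy_lt_top (hd : 0 < d) (hQ : Continuous (extField w)) (n : ℕ) :
    ∃ ν : Measure ℝ, ν univ = n ∧ energy d w ν < ∞ := by
  refine ⟨(n : ℝ≥0∞) • volume.restrict (Icc (0 : ℝ) 1), by simp, ?_⟩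
  rw [energy_smul _ (ENNReal.natCast_ne_top n)]
  have h1 := lintegral_kernel_unit_lt_top hd
  have h2 : fieldIntegral w (volume.restrict (Icc (0 : ℝ) 1)) < ∞ := by
    exact (hQ.integrableOn_Icc).lintegral_lt_top
  have := ENNReal.natCast_lt_top n
  exact ENNReal.add_lt_top.2 ⟨ENNReal.mul_lt_top this (ENNReal.mul_lt_top this h1),
    ENNReal.mul_lt_top (by simp) (ENNReal.mul_lt_top this h2)⟩

/-- The measures of mass `n` are parametrized as `n • p` with `p` a probability measure, for which
the weak topology and Prokhorov's theorem are available. -/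
lemma lowerSemicontinuous_energy_smul (hd : 0 < d) (hQ : Continuous (extField w)) (n : ℕ) :
    LowerSemicontinuous fun p : ProbabilityMeasure ℝ =>
      energy d w ((n : ℝ≥0∞) • (p : Measure ℝ)) := by
  have hn : (n : ℝ≥0∞) ≠ ∞ := ENNReal.natCast_ne_top n
  have hk : Continuous fun z : ℝ × ℝ => kernel d (z.1 - z.2) :=
    (continuous_kernel hd).comp (by fun_prop)
  have hq : Continuous fun x => ENNReal.ofReal (extField w x) :=
    ENNReal.continuous_ofReal.comp hQ
  have e : ∀ p : ProbabilityMeasure ℝ, energy d w ((n : ℝ≥0∞) • (p : Measure ℝ)) =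
      ∫⁻ z : ℝ × ℝ, n * (n * kernel d (z.1 - z.2)) ∂(p.prod p : ProbabilityMeasure (ℝ × ℝ))
        + ∫⁻ x, 2 * (n * ENNReal.ofReal (extField w x)) ∂(p : Measure ℝ) := by
    intro p
    rw [energy_smul _ hn, lintegral_const_mul' _ _ hn, lintegral_const_mul' _ _ hn,
      lintegral_const_mul' _ _ ENNReal.ofNat_ne_top, lintegral_const_mul' _ _ hn,
      ProbabilityMeasure.toMeasure_prod, lintegral_prod_symm _ hk.measurable.aemeasurable]
    rfl
  simp_rw [e]
  refine LowerSemicontinuous.add ?_ ?_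
  · refine (lowerSemicontinuous_lintegral (g := fun z : ℝ × ℝ => n * (n * kernel d (z.1 - z.2)))
      ?_).comp (g := fun p : ProbabilityMeasure ℝ => p.prod p) (by fun_prop)
    exact (ENNReal.continuous_const_mul hn).comp ((ENNReal.continuous_const_mul hn).comp hk)
  · refine lowerSemicontinuous_lintegral ?_
    exact (ENNReal.continuous_const_mul ENNReal.ofNat_ne_top).comp
      ((ENNReal.continuous_const_mul hn).comp hq)

lemma exists_isEnergyMinimizer (hd : 0 < d) (hQ : Continuous (extField w))
    (hQ' : Tendsto (extField w) (cocompact ℝ) atTop) {n : ℕ} (hn : n ≠ 0) :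
    ∃ μ : Measure ℝ, IsEnergyMinimizer d w n μ := by
  obtain ⟨ν, hν, hνE⟩ := exists_energy_lt_top hd hQ n
  have hn0 : (n : ℝ≥0∞) ≠ 0 := by exact_mod_cast hn
  have hnt : (n : ℝ≥0∞) ≠ ∞ := ENNReal.natCast_ne_top n
  have hrep : ∀ σ : Measure ℝ, σ univ = n →
      ∃ p : ProbabilityMeasure ℝ, (n : ℝ≥0∞) • (p : Measure ℝ) = σ := by
    intro σ hσ
    refine ⟨⟨(n : ℝ≥0∞)⁻¹ • σ, ⟨?_⟩⟩, ?_⟩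
    · rw [Measure.smul_apply, hσ, smul_eq_mul, ENNReal.inv_mul_cancel hn0 hnt]
    · simp [smul_smul, ENNReal.mul_inv_cancel hn0 hnt]
  have hlsc := lowerSemicontinuous_energy_smul hd hQ n
  set J := fun p : ProbabilityMeasure ℝ => energy d w ((n : ℝ≥0∞) • (p : Measure ℝ)) with hJ
  set S : Set (ProbabilityMeasure ℝ) := {p | J p ≤ energy d w ν} with hS
  have hSc : IsClosed S := hlsc.isClosed_preimage _
  have hST : IsTightMeasureSet {((p : ProbabilityMeasure ℝ) : Measure ℝ) | p ∈ S} := by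
    rw [isTightMeasureSet_iff_exists_isCompact_measure_compl_le]
    intro ε hε
    -- Chebyshev's inequality for `Q`, which is at least `M` off a compact set.
    obtain ⟨M, hM0, hM⟩ : ∃ M : ℝ, 0 < M ∧ energy d w ν / ENNReal.ofReal M ≤ ε := by
      have h1 : Tendsto (fun M : ℝ => energy d w ν / ENNReal.ofReal M) atTop (𝓝 0) := by
        have := ENNReal.Tendsto.const_div ENNReal.tendsto_ofReal_atTop
          (Or.inr hνE.ne) (a := energy d w ν)
        simpa using this
      obtain ⟨M, h, h'⟩ := ((h1.eventually (gt_mem_nhds hε)).and (eventually_gt_atTop 0)).exists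
      exact ⟨M, h', h.le⟩
    obtain ⟨K, hK, hKM⟩ := mem_cocompact.1 (hQ'.eventually_ge_atTop M)
    refine ⟨K, hK, ?_⟩
    rintro _ ⟨p, hp, rfl⟩
    refine le_trans ?_ hM
    rw [ENNReal.le_div_iff_mul_le (Or.inl (by simpa using hM0)) (Or.inl ENNReal.ofReal_ne_top)]
    have h1 : fieldIntegral w (p : Measure ℝ) ≤ energy d w ν := by
      have hn1 : (1 : ℝ≥0∞) ≤ n := by exact_mod_cast Nat.one_le_iff_ne_zero.2 hn
      have h2 : 1 * (1 * fieldIntegral w (p : Measure ℝ)) ≤ energy d w ν := by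
        refine le_trans ?_ (hp : J p ≤ _)
        rw [hJ]
        simp only [energy_smul _ hnt]
        refine le_trans ?_ le_add_self
        gcongr
        norm_num
      simpa using h2
    refine le_trans ?_ h1
    calc (p : Measure ℝ) Kᶜ * ENNReal.ofReal M = ∫⁻ x in Kᶜ, ENNReal.ofReal M ∂(p : Measure ℝ) := by
          rw [setLIntegral_const, mul_comm]
      _ ≤ ∫⁻ x in Kᶜ, ENNReal.ofReal (extField w x) ∂(p : Measure ℝ) :=
          setLIntegral_mono (by fun_prop) fun x hx => ENNReal.ofReal_le_ofReal (hKM hx)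
      _ ≤ _ := setLIntegral_le_lintegral _ _
  have hScomp : IsCompact S := by
    have := isCompact_closure_of_isTightMeasureSet hST
    rwa [hSc.closure_eq] at this
  obtain ⟨p₀, hp₀⟩ := hrep ν hν
  obtain ⟨p, hpS, hp⟩ := LowerSemicontinuousOn.exists_isMinOn
    ⟨p₀, by simp [hS, hJ, hp₀]⟩ hScomp (hlsc.lowerSemicontinuousOn S)
  refine ⟨(n : ℝ≥0∞) • (p : Measure ℝ), by simp, fun σ hσ => ?_⟩
  obtain ⟨q, rfl⟩ := hrep σ hσ
  by_cases hq : q ∈ S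
  · exact hp hq
  · exact le_trans hpS (not_le.1 hq).le

/-! ### The external field -/

lemma IsWeight.re_pos (hw : IsWeight d w) (x : ℝ) : 0 < (w x).re := by
  obtain ⟨r, hr, h⟩ := hw.real_values x
  rw [h]; exact hr.1

lemma IsWeight.extField_nonneg (hw : IsWeight d w) (x : ℝ) : 0 ≤ extField w x := by
  obtain ⟨r, hr, h⟩ := hw.real_values x
  rw [extField, h, Complex.ofReal_re, neg_nonneg]
  exact Real.log_nonpos hr.1.le hr.2

lemma IsWeight.contDiff_extField (hd : 0 < d) (hw : IsWeight d w) :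
    ContDiff ℝ 1 (extField w) := by
  refine contDiff_iff_contDiffAt.2 fun x => ?_
  have h1 : ContDiffAt ℂ 1 w (x : ℂ) := (hw.analytic x (by simpa [strip] using hd)).contDiffAt
  have h2 : ContDiffAt ℝ 1 (fun x : ℝ => (w x).re) x := h1.real_of_complex
  exact (h2.log (hw.re_pos x).ne').neg

lemma IsWeight.strictConvexOn_extField (hw : IsWeight d w) :
    StrictConvexOn ℝ univ (extField w) := hw.log_concave.neg

lemma extField_neg (heven : ∀ x : ℝ, w ((-x : ℝ) : ℂ) = w (x : ℂ)) (x : ℝ) :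
    extField w (-x) = extField w x := by
  rw [extField, heven, extField]

lemma extField_zero_lt (hw : IsWeight d w)
    (heven : ∀ x : ℝ, w ((-x : ℝ) : ℂ) = w (x : ℂ)) {x : ℝ} (hx : x ≠ 0) :
    extField w 0 < extField w x := by
  have := hw.strictConvexOn_extField.2 (mem_univ x) (mem_univ (-x))
    (by intro h; apply hx; linarith) (by norm_num : (0 : ℝ) < 1 / 2)
    (by norm_num : (0 : ℝ) < 1 / 2) (by norm_num)
  simp only [smul_eq_mul, extField_neg heven] at this
  have e : (1 / 2 : ℝ) * x + 1 / 2 * -x = 0 := by ring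
  rw [e] at this
  linarith

/-- An even convex function is monotone in the absolute value. -/
lemma extField_le_of_abs_le (hw : IsWeight d w)
    (heven : ∀ x : ℝ, w ((-x : ℝ) : ℂ) = w (x : ℂ)) {x y : ℝ} (h : |x| ≤ |y|) :
    extField w x ≤ extField w y := by
  have h1 := hw.strictConvexOn_extField.convexOn.le_max_of_mem_Icc (mem_univ (-|y|))
    (mem_univ |y|) (abs_le.1 h)
  rw [extField_neg heven, max_self] at h1
  rcases abs_choice y with e | e <;> rw [e] at h1
  · exact h1
  · rwa [extField_neg heven] at h1

/-- Convexity and `Q(0) < Q(1)` force at least linear growth. -/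
lemma tendsto_extField (hw : IsWeight d w)
    (heven : ∀ x : ℝ, w ((-x : ℝ) : ℂ) = w (x : ℂ)) :
    Tendsto (extField w) (cocompact ℝ) atTop := by
  have h0 := extField_zero_lt hw heven one_ne_zero
  have h1 : Tendsto (fun x : ℝ => ‖x‖ * (extField w 1 - extField w 0)) (cocompact ℝ) atTop :=
    (tendsto_norm_cocompact_atTop).atTop_mul_const (by linarith)
  refine tendsto_atTop_mono' _ ?_ h1
  filter_upwards [tendsto_norm_cocompact_atTop.eventually_ge_atTop 1] with x hx
  rw [Real.norm_eq_abs] at hx ⊢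
  have hx0 : 0 < |x| := lt_of_lt_of_le one_pos hx
  have h2 := hw.strictConvexOn_extField.convexOn.2 (mem_univ (|x|)) (mem_univ 0)
    (by positivity : 0 ≤ |x|⁻¹) (sub_nonneg.2 (inv_le_one_of_one_le₀ (hx : 1 ≤ |x|))) (by ring)
  simp only [smul_eq_mul, inv_mul_cancel₀ hx0.ne', mul_zero, add_zero] at h2
  have h3 : extField w |x| = extField w x :=
    le_antisymm (extField_le_of_abs_le hw heven (by simp))
      (extField_le_of_abs_le hw heven (by simp))
  rw [h3] at h2
  have h4 : |x| * extField w 1 ≤ extField w x + (|x| - 1) * extField w 0 := by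
    calc |x| * extField w 1 ≤ |x| * _ := mul_le_mul_of_nonneg_left h2 hx0.le
      _ = _ := by field_simp
  have := hw.extField_nonneg 0
  nlinarith

lemma abs_deriv_extField_le (hw : IsWeight d w)
    (heven : ∀ x : ℝ, w ((-x : ℝ) : ℂ) = w (x : ℂ)) (hd : 0 < d) {x α : ℝ} (hx : x ∈ Icc (-α) α) :
    |deriv (extField w) x| ≤ deriv (extField w) α := by
  have hm : MonotoneOn (deriv (extField w)) univ :=
    hw.strictConvexOn_extField.convexOn.monotoneOn_deriv fun x _ =>
      (hw.contDiff_extField hd).differentiable one_ne_zero x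
  have hodd : deriv (extField w) (-α) = -deriv (extField w) α := by
    have h1 := deriv_comp_neg (extField w) α
    have h2 : (fun x => extField w (-x)) = extField w := funext (extField_neg heven)
    rw [h2] at h1
    linarith
  rw [abs_le, ← hodd]
  exact ⟨hm (mem_univ _) (mem_univ _) hx.1, hm (mem_univ _) (mem_univ _) hx.2⟩

/-- The Sobolev norm of `Q(α) - Q` on `[-α, α]`, where this function lies between `0` and `Q(α)` and
its derivative is bounded by `Q'(α)`. -/
lemma setIntegral_sq_field_le (hw : IsWeight d w)
    (heven : ∀ x : ℝ, w ((-x : ℝ) : ℂ) = w (x : ℂ)) (hd : 0 < d) {a α : ℝ} (hα : 0 < α) :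
    ∫ t in Icc (-α) α, (a * (extField w α - extField w t) - -deriv (extField w) t) ^ 2
      ≤ 2 * α * (a ^ 2 * extField w α ^ 2 + deriv (extField w) α ^ 2) := by
  have hC := hw.contDiff_extField hd
  have hd1 : Continuous (deriv (extField w)) := hC.continuous_deriv le_rfl
  have hc : Continuous (extField w) := hC.continuous
  have hder : ∀ x, HasDerivAt (fun t => extField w α - extField w t)
      (-deriv (extField w) x) x := fun x =>
    ((hC.differentiable one_ne_zero x).hasDerivAt).const_sub _
  rw [integral_sq_sub_deriv (f := fun t => extField w α - extField w t) (by linarith) hder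
    hd1.neg (by simp [extField_neg heven]) (by simp)]
  have hv : volume.real (Icc (-α) α) = 2 * α := by
    rw [Real.volume_real_Icc_of_le (by linarith)]; ring
  have b1 : ∫ t in Icc (-α) α, (extField w α - extField w t) ^ 2 ≤ extField w α ^ 2 * (2 * α) := by
    rw [← hv, mul_comm, ← smul_eq_mul, ← setIntegral_const]
    refine setIntegral_mono_on (Continuous.integrableOn_Icc (by fun_prop))
      (Continuous.integrableOn_Icc (by fun_prop)) measurableSet_Icc fun t ht => ?_
    have h1 := hw.extField_nonneg t
    have h2 := extField_le_of_abs_le hw heven ((abs_le.2 ht).trans (le_abs_self α))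
    exact pow_le_pow_left₀ (by linarith) (by linarith) 2
  have b2 : ∫ t in Icc (-α) α, (-deriv (extField w) t) ^ 2
      ≤ deriv (extField w) α ^ 2 * (2 * α) := by
    rw [← hv, mul_comm, ← smul_eq_mul, ← setIntegral_const]
    refine setIntegral_mono_on (Continuous.integrableOn_Icc (by fun_prop))
      (Continuous.integrableOn_Icc (by fun_prop)) measurableSet_Icc fun t ht => ?_
    rw [neg_sq, sq_le_sq]
    exact (abs_deriv_extField_le hw heven hd ht).trans (le_abs_self _)
  nlinarith [mul_le_mul_of_nonneg_left b1 (sq_nonneg a)]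

/-! ### The lower bound -/

lemma sum_odd_sq (N : ℕ) :
    ∑ j ∈ Finset.range N, ((2 * j + 1 : ℝ)) ^ 2 = N * (4 * N ^ 2 - 1) / 3 := by
  induction N with
  | zero => simp
  | succ N ih => rw [Finset.sum_range_succ, ih]; push_cast; ring

/-- The full series equals `2 tanh (ω d) / (ω P)` with `ω = √(R / P)`. For the weaker bound stated,
finitely many terms and the inequalities `tanh d ≤ 1`, `tanh d ≤ d` suffice. -/
lemma tanh_div_le_sum (hd : 0 < d) {P R : ℝ} (hP : 0 < P) (hR : 0 ≤ R) :
    ∃ N : ℕ, Real.tanh d / (P + R) ≤ ∑ j ∈ Finset.range N,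
      4 / d / (((2 * j + 1) * Real.pi / (2 * d)) ^ 2 * P + R) := by
  refine ⟨⌈d / 4⌉₊, ?_⟩
  set N := ⌈d / 4⌉₊ with hN
  have hpi0 := Real.pi_pos
  have hpi : Real.pi ^ 2 ≤ 12 := by nlinarith [Real.pi_lt_d2]
  have hN1 : d / 4 ≤ N := Nat.le_ceil _
  have hN2 : (N : ℝ) < d / 4 + 1 := Nat.ceil_lt_add_one (by positivity)
  have hN0 : 1 ≤ N := Nat.one_le_ceil_iff.2 (by positivity)
  have hN0' : (1 : ℝ) ≤ N := by exact_mod_cast hN0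
  -- By convexity each denominator may be replaced by the average one.
  have hsed := Finset.sq_sum_div_le_sum_sq_div (Finset.range N) (fun _ => (1 : ℝ))
    (g := fun j : ℕ => ((2 * j + 1) * Real.pi / (2 * d)) ^ 2 * P + R)
    (fun j _ => by positivity)
  have hsum : ∑ j ∈ Finset.range N, (((2 * j + 1) * Real.pi / (2 * d)) ^ 2 * P + R)
      = N * ((4 * N ^ 2 - 1) / 3 * (Real.pi / (2 * d)) ^ 2 * P + R) := by
    have : ∀ j : ℕ, ((2 * j + 1) * Real.pi / (2 * d)) ^ 2 * P + R
        = (2 * j + 1 : ℝ) ^ 2 * ((Real.pi / (2 * d)) ^ 2 * P) + R := by intro j; ring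
    simp_rw [this]
    rw [Finset.sum_add_distrib, ← Finset.sum_mul, sum_odd_sq]
    simp; ring
  rw [hsum] at hsed
  simp only [Finset.sum_const, Finset.card_range, nsmul_eq_mul, mul_one, one_pow] at hsed
  have hfac : ∑ j ∈ Finset.range N, 4 / d / (((2 * j + 1) * Real.pi / (2 * d)) ^ 2 * P + R)
      = 4 / d * ∑ j ∈ Finset.range N, 1 / (((2 * j + 1) * Real.pi / (2 * d)) ^ 2 * P + R) := by
    rw [Finset.mul_sum]; exact Finset.sum_congr rfl fun j _ => by ring
  rw [hfac]
  refine le_trans ?_ (mul_le_mul_of_nonneg_left hsed (by positivity))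
  set M := (4 * (N : ℝ) ^ 2 - 1) / 3 * (Real.pi / (2 * d)) ^ 2 with hM
  have hMpos : 0 < M := by
    have : 0 < (4 * (N : ℝ) ^ 2 - 1) := by nlinarith
    positivity
  have e : 4 / d * ((N : ℝ) ^ 2 / (N * (M * P + R))) = (4 * N / d) / (M * P + R) := by
    field_simp
  rw [e, div_le_div_iff₀ (by positivity) (by positivity)]
  have ht1 := (Real.tanh_lt_one d).le
  have ht2 := tanh_le_self hd.le
  have ht0 := tanh_pos hd
  -- It is enough to compare the coefficients of `P` and of `R`.
  have c1 : Real.tanh d * M ≤ 4 * N / d := by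
    rcases le_or_gt d 4 with h | h
    · have hN' : N = 1 := le_antisymm (Nat.ceil_le.2 (by push_cast; linarith)) hN0
      have e1 : Real.tanh d * M = Real.tanh d * Real.pi ^ 2 / (4 * d ^ 2) := by
        rw [hM, hN']; push_cast; field_simp; ring
      rw [e1, hN', div_le_div_iff₀ (by positivity) hd]
      have : Real.tanh d * Real.pi ^ 2 ≤ d * 12 := mul_le_mul ht2 hpi (by positivity) hd.le
      push_cast
      nlinarith
    · have hNd : (N : ℝ) ≤ d := by linarith
      calc Real.tanh d * M ≤ 1 * M := mul_le_mul_of_nonneg_right ht1 hMpos.le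
        _ ≤ 4 * N * N / d ^ 2 := by
          rw [one_mul, hM, div_pow, ← mul_div_assoc, div_le_div_iff₀ (by positivity) (by positivity)]
          have : (4 * (N : ℝ) ^ 2 - 1) / 3 * Real.pi ^ 2 ≤ 4 * N ^ 2 / 3 * 12 :=
            mul_le_mul (by linarith) hpi (by positivity) (by positivity)
          nlinarith [mul_le_mul_of_nonneg_right this (sq_nonneg d)]
        _ ≤ 4 * N * d / d ^ 2 := by gcongr
        _ = 4 * N / d := by field_simp
  have c2 : Real.tanh d ≤ 4 * N / d := by
    rw [le_div_iff₀ hd]; nlinarith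
  nlinarith [mul_le_mul_of_nonneg_right c1 hP.le, mul_le_mul_of_nonneg_right c2 hR]

/-- Both the truncation of the series and the restriction to `s` only lower the energy, as the kernel
is nonnegative. -/
lemma sum_expEnergy_le (hd : 0 < d) (N : ℕ) (μ : Measure ℝ) [IsFiniteMeasure μ] (s : Set ℝ)
    (hE : ∫⁻ z : ℝ × ℝ, kernel d (z.1 - z.2) ∂(μ.prod μ) ≠ ∞) :
    ∑ j ∈ Finset.range N, 2 / (2 * j + 1 : ℝ) *
      ∫ z, Real.exp (-((2 * j + 1) * Real.pi / (2 * d)) * |z.1 - z.2|)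
        ∂((μ.restrict s).prod (μ.restrict s))
      ≤ (∫⁻ z : ℝ × ℝ, kernel d (z.1 - z.2) ∂(μ.prod μ)).toReal := by
  have hint : ∀ j : ℕ, Integrable (fun z : ℝ × ℝ =>
      Real.exp (-((2 * j + 1) * Real.pi / (2 * d)) * |z.1 - z.2|))
      ((μ.restrict s).prod (μ.restrict s)) := fun j => by
    refine Integrable.of_bound (Continuous.aestronglyMeasurable (by fun_prop)) 1
      (ae_of_all _ fun z => ?_)
    rw [Real.norm_of_nonneg (Real.exp_pos _).le, Real.exp_le_one_iff, neg_mul, neg_nonpos]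
    positivity
  set G : ℕ → ℝ × ℝ → ℝ := fun j z => 2 / (2 * j + 1 : ℝ) *
    Real.exp (-((2 * j + 1) * Real.pi / (2 * d)) * |z.1 - z.2|) with hG
  have hGc : ∀ j, Continuous (G j) := fun j => by simp only [hG]; fun_prop
  have hG0 : ∀ j z, 0 ≤ G j z := fun j z => by simp only [hG]; positivity
  have e : ∀ j : ℕ, 2 / (2 * j + 1 : ℝ) *
      ∫ z, Real.exp (-((2 * j + 1) * Real.pi / (2 * d)) * |z.1 - z.2|)
        ∂((μ.restrict s).prod (μ.restrict s))
      = ∫ z, G j z ∂((μ.restrict s).prod (μ.restrict s)) := fun j =>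
    (integral_const_mul _ _).symm
  rw [Finset.sum_congr rfl fun j _ => e j,
    ← integral_finsetSum _ fun j _ => (hint j).const_mul _,
    integral_eq_lintegral_of_nonneg_ae (ae_of_all _ fun z => Finset.sum_nonneg fun j _ => hG0 j z)
      (continuous_finsetSum _ fun j _ => hGc j).aestronglyMeasurable]
  refine ENNReal.toReal_mono hE ?_
  rw [Measure.prod_restrict]
  refine le_trans ?_ (setLIntegral_le_lintegral (s ×ˢ s) _)
  exact lintegral_mono fun z => sum_exp_le_kernel hd N (z.1 - z.2)

/-- The square of the linear functional defined by `Q(α) - Q` on `[-α, α]` is controlled by the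
kernel energy. -/
lemma sq_integral_field_le (hd : 0 < d) (hw : IsWeight d w)
    (heven : ∀ x : ℝ, w ((-x : ℝ) : ℂ) = w (x : ℂ)) {α : ℝ} (hα : 0 < α)
    (μ : Measure ℝ) [IsFiniteMeasure μ]
    (hE : ∫⁻ z : ℝ × ℝ, kernel d (z.1 - z.2) ∂(μ.prod μ) ≠ ∞) :
    (∫ x in Icc (-α) α, (extField w α - extField w x) ∂μ) ^ 2 * (Real.pi * Real.tanh d / 2) ≤
      2 * α * (extField w α ^ 2 + deriv (extField w) α ^ 2) *
        (∫⁻ z : ℝ × ℝ, kernel d (z.1 - z.2) ∂(μ.prod μ)).toReal := by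
  set B := ∫ x in Icc (-α) α, (extField w α - extField w x) ∂μ with hB
  set E := (∫⁻ z : ℝ × ℝ, kernel d (z.1 - z.2) ∂(μ.prod μ)).toReal
  have hC := hw.contDiff_extField hd
  have hq : 0 < extField w α :=
    lt_of_le_of_lt (hw.extField_nonneg 0) (extField_zero_lt hw heven hα.ne')
  set P := 2 * α * extField w α ^ 2 with hP
  set R := 2 * α * deriv (extField w) α ^ 2 with hR
  have hP0 : 0 < P := by positivity
  have hR0 : 0 ≤ R := by positivity
  obtain ⟨N, hN⟩ := tanh_div_le_sum hd hP0 hR0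
  have hpi := Real.pi_pos
  have hterm : ∀ j : ℕ, Real.pi / 2 * B ^ 2 *
      (4 / d / (((2 * j + 1) * Real.pi / (2 * d)) ^ 2 * P + R)) ≤ 2 / (2 * j + 1 : ℝ) *
      ∫ z, Real.exp (-((2 * j + 1) * Real.pi / (2 * d)) * |z.1 - z.2|)
        ∂((μ.restrict (Icc (-α) α)).prod (μ.restrict (Icc (-α) α))) := by
    intro j
    set a := (2 * j + 1) * Real.pi / (2 * d) with ha
    have ha0 : 0 < a := by positivity
    have h1 := sq_integral_le_mul_expEnergy (b := -α) (c := α) ha0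
      (f := fun t => extField w α - extField w t) (f' := fun t => -deriv (extField w) t)
      (fun x => ((hC.differentiable one_ne_zero x).hasDerivAt).const_sub _)
      (hC.continuous_deriv le_rfl).neg (by simp) (μ.restrict (Icc (-α) α))
      (ae_restrict_mem measurableSet_Icc)
    have h2 := setIntegral_sq_field_le hw heven hd (a := a) hα
    set Z := ∫ z : ℝ × ℝ, Real.exp (-a * |z.1 - z.2|)
        ∂((μ.restrict (Icc (-α) α)).prod (μ.restrict (Icc (-α) α))) with hZ
    have hZ0 : 0 ≤ Z := integral_nonneg fun z => (Real.exp_pos _).le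
    have h3 : 2 * a * B ^ 2 ≤ (a ^ 2 * P + R) * Z := by
      refine (h1.trans (mul_le_mul_of_nonneg_right h2 hZ0)).trans (le_of_eq ?_)
      rw [hP, hR]; ring
    have hD : 0 < a ^ 2 * P + R := by positivity
    have h4 : 2 * a * B ^ 2 / (a ^ 2 * P + R) ≤ Z := (div_le_iff₀' hD).2 h3
    calc Real.pi / 2 * B ^ 2 * (4 / d / (a ^ 2 * P + R))
        = 2 / (2 * j + 1 : ℝ) * (2 * a * B ^ 2 / (a ^ 2 * P + R)) := by
          have : Real.pi / d = 2 * a / (2 * j + 1) := by rw [ha]; field_simp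
          calc _ = 2 * B ^ 2 / (a ^ 2 * P + R) * (Real.pi / d) := by ring
            _ = _ := by rw [this]; ring
      _ ≤ _ := by gcongr
  have h5 : Real.pi / 2 * B ^ 2 * (Real.tanh d / (P + R)) ≤ E :=
    calc Real.pi / 2 * B ^ 2 * (Real.tanh d / (P + R)) ≤ _ :=
          mul_le_mul_of_nonneg_left hN (by positivity)
      _ ≤ _ := by rw [Finset.mul_sum]; exact Finset.sum_le_sum fun j _ => hterm j
      _ ≤ E := sum_expEnergy_le hd N μ _ hE
  have h6 : B ^ 2 * (Real.pi * Real.tanh d / 2) / (P + R) ≤ E := by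
    refine le_trans (le_of_eq ?_) h5; ring
  rw [div_le_iff₀ (by positivity)] at h6
  rw [hP, hR] at h6
  linarith

/-- The lower bound for an arbitrary measure of mass `n` with finite energy. -/
theorem half_mul_field_le_FC (hd : 0 < d) (hw : IsWeight d w)
    (heven : ∀ x : ℝ, w ((-x : ℝ) : ℂ) = w (x : ℂ)) {n : ℕ} {α : ℝ} (hα : 0 < α)
    (hαn : 2 * α / (Real.pi * Real.tanh d) *
        ((extField w α ^ 2 + deriv (extField w) α ^ 2) / extField w α) ≤ (n : ℝ))
    {μ : Measure ℝ} (hμ : μ univ = n) (hE : energy d w μ ≠ ∞) :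
    n * extField w α / 2 ≤ FC d w μ := by
  have : IsFiniteMeasure μ := ⟨by rw [hμ]; exact ENNReal.natCast_lt_top n⟩
  rw [energy_eq_prod hd] at hE
  obtain ⟨hE1, hE2⟩ := ENNReal.add_ne_top.1 hE
  have hF : fieldIntegral w μ ≠ ∞ := fun h => hE2 (by rw [h]; simp)
  have hB := sq_integral_field_le hd hw heven hα μ hE1
  rw [FC, energy_eq_prod hd, ENNReal.toReal_add hE1 hE2, ENNReal.toReal_mul, ENNReal.toReal_ofNat]
  set E := (∫⁻ z : ℝ × ℝ, kernel d (z.1 - z.2) ∂(μ.prod μ)).toReal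
  set B := ∫ x in Icc (-α) α, (extField w α - extField w x) ∂μ with hBdef
  have hE0 : 0 ≤ E := ENNReal.toReal_nonneg
  have hc : Continuous (extField w) := (hw.contDiff_extField hd).continuous
  have hq : 0 < extField w α :=
    lt_of_le_of_lt (hw.extField_nonneg 0) (extField_zero_lt hw heven hα.ne')
  -- Off the interval the field exceeds its value at the end point.
  have hFB : n * extField w α ≤ (fieldIntegral w μ).toReal + B := by
    have hnn : 0 ≤ᵐ[μ] extField w := ae_of_all _ hw.extField_nonneg
    have hi : Integrable (extField w) μ :=
      ⟨hc.aestronglyMeasurable, (hasFiniteIntegral_iff_ofReal hnn).2 hF.lt_top⟩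
    have hi2 : Integrable (fun x => (Icc (-α) α).indicator
        (fun x => extField w α - extField w x) x) μ :=
      ((integrable_const _).sub hi).indicator measurableSet_Icc
    have e1 : (fieldIntegral w μ).toReal = ∫ x, extField w x ∂μ :=
      (integral_eq_lintegral_of_nonneg_ae hnn hc.aestronglyMeasurable).symm
    have e2 : n * extField w α = ∫ _, extField w α ∂μ := by
      rw [integral_const, Measure.real, hμ]; simp
    rw [e1, e2, hBdef, ← integral_indicator measurableSet_Icc, ← integral_add hi hi2]
    refine integral_mono (integrable_const _) (hi.add hi2) fun x => ?_
    by_cases hx : x ∈ Icc (-α) α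
    · simp [indicator_of_mem hx]
    · simp only [indicator_of_notMem hx, add_zero]
      refine extField_le_of_abs_le hw heven ?_
      rw [abs_of_pos hα]
      by_contra h
      exact hx (abs_le.1 (not_le.1 h).le)
  have ht : 0 < Real.pi * Real.tanh d := mul_pos Real.pi_pos (tanh_pos hd)
  have hn : 2 * α * (extField w α ^ 2 + deriv (extField w) α ^ 2)
      ≤ n * extField w α * (Real.pi * Real.tanh d) := by
    rw [div_mul_div_comm, div_le_iff₀ (by positivity)] at hαn
    linarith
  have hBE : B ^ 2 ≤ 2 * (n * extField w α) * E := by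
    have := hB.trans (mul_le_mul_of_nonneg_right hn hE0)
    refine le_of_mul_le_mul_right ?_ ht
    linarith
  -- The arithmetic-geometric mean inequality for `E` and `n Q(α) / 2`.
  have hBle : B ≤ E + n * extField w α / 2 := by
    refine le_of_sq_le_sq ?_ (by positivity)
    nlinarith [sq_nonneg (E - n * extField w α / 2)]
  linarith

end WeightedHardy

theorem theorem2 (d : ℝ) (hd : 0 < d) (w : ℂ → ℂ) (hw : WeightedHardy.IsWeight d w)
    (heven : ∀ x : ℝ, w ((-x : ℝ) : ℂ) = w (x : ℂ))
    (n : ℕ) (hn : 1 ≤ n) (α : ℝ) (hα : 0 < α)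
    (hαn : 2 * α / (Real.pi * Real.tanh d) *
        ((WeightedHardy.extField w α ^ 2 + deriv (WeightedHardy.extField w) α ^ 2) /
          WeightedHardy.extField w α) ≤ (n : ℝ)) :
    (∃ μ : MeasureTheory.Measure ℝ, WeightedHardy.IsEnergyMinimizer d w n μ) ∧
      ∀ μ : MeasureTheory.Measure ℝ, WeightedHardy.IsEnergyMinimizer d w n μ →
        WeightedHardy.extField w α / 2 ≤ WeightedHardy.FC d w μ / (n : ℝ) := by
  have hc := (hw.contDiff_extField hd).continuous
  refine ⟨WeightedHardy.exists_isEnergyMinimizer hd hc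
    (WeightedHardy.tendsto_extField hw heven) (by omega), fun μ hμ => ?_⟩
  obtain ⟨ν, hν, hνE⟩ := WeightedHardy.exists_energy_lt_top hd hc n
  have h := WeightedHardy.half_mul_field_le_FC hd hw heven hα hαn hμ.1
    ((hμ.2 ν hν).trans_lt hνE).ne
  have hn0 : (0 : ℝ) < n := by exact_mod_cast hn
  rw [le_div_iff₀ hn0]
  linarith
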